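/- Let $\mathcal{C}$ be an elementary topos (a finitely complete cartesian closed category with a subobject classifier $\Omega$), let $X$ be an object of $\mathcal{C}$ with power object $PX=\Omega^X$, internal meet $\wedge$ and internal order $\preceq_X$ on $PX$ (the equalizer of $\wedge$ and the first projection $PX\times PX\to PX$), and write $X$ also for the term $\{x:X\mid \mathrm{true}\}$ of type $PX$. All formulas below are formulas of the internal (Mitchell--Bénabou) language of $\mathcal{C}$, and a closed formula is said to hold if its interpretation, a subobject of the terminal object, is the top one. Let $N:X\to PPX$ be a morphism that is a topological neighborhood, i.e. such that the following formulas hold in $\mathcal{C}$: (a) $\forall x.\ \mathcal{F}(N(x))$, where $\mathcal{F}:PPX\to\Omega$ is the morphism defined by the conjunction of the following four formulas in the variable $F:PPX$ ("$F$ is a filter"): $\forall A.\forall B.\ A\in_{PX}F\wedge B\in_{PX}F\Rightarrow A\wedge B\in_{PX}F$; $\ \forall A.\forall B.\ A\in_{PX}F\wedge A\preceq_X B\Rightarrow B\in_{PX}F$; $\ X\in_{PX}F$; $\ \forall A.\ A\in_{PX}F\Rightarrow\exists x.\ x\in_X A$; (b) $\forall x.\forall A.\ A\in_{PX}N(x)\Rightarrow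 x\in_X A$; (c) $\forall x.\forall A.\ A\in_{PX}N(x)\Rightarrow\exists B.\ \bigl(B\in_{PX}N(x)\wedge(\forall y.\ y\in_X B\Rightarrow A\in_{PX}N(y))\bigr)$. Let the erosion $\varepsilon[N]:PX\to PX$ be the morphism defined by $\varepsilon[N](Y)=\{x:X\mid Y\in_{PX}N(x)\}$. Then $\varepsilon[N]$ is an internal interior operator on $PX$, that is, the following formulas hold in $\mathcal{C}$: 1. $\forall Y.\ \varepsilon[N](Y)\preceq_X Y$; 2. $\varepsilon[N](X)=X$; 3. $\forall Y.\forall Z.\ \varepsilon[N](Y\wedge Z)=\varepsilon[N](Y)\wedge\varepsilon[N](Z)$; 4. $\forall Y.\ \varepsilon[N](\varepsilon[N](Y))=\varepsilon[N](Y)$. -/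

import Mathlib

open CategoryTheory Limits MonoidalCategory CartesianMonoidalCategory

universe v u

noncomputable section

namespace ToposLogic

/-! An elementary topos is a category `C` with finite limits (with chosen finite products
`CartesianMonoidalCategory C`), exponentials (`MonoidalClosed C`) and a subobject classifier.
The internal language is interpreted as follows: a context `x₁ : X₁, …, xₙ : Xₙ` is the product
`Xₙ ⊗ (… ⊗ (X₁ ⊗ 𝟙_ C))`, a term of type `X` in a context `Γ` is a morphism `Γ ⟶ X`, and a formula
in a context `Γ` is a subobject of `Γ`. -/

variable {C : Type u} [Category.{v} C] [CartesianMonoidalCategory C] [HasFiniteLimits C]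
  [MonoidalClosed C] [HasSubobjectClassifier C]

/-! ### Variables -/

section Variables

variable {A B D E Γ : C}

/-- The last variable of a context. -/
abbrev v0 : A ⊗ Γ ⟶ A := fst _ _

/-- The last but one variable of a context. -/
abbrev v1 : A ⊗ (B ⊗ Γ) ⟶ B := snd _ _ ≫ fst _ _

/-- The last but two variable of a context. -/
abbrev v2 : A ⊗ (B ⊗ (D ⊗ Γ)) ⟶ D := snd _ _ ≫ snd _ _ ≫ fst _ _

/-- The last but three variable of a context. -/
abbrev v3 : A ⊗ (B ⊗ (D ⊗ (E ⊗ Γ))) ⟶ E := snd _ _ ≫ snd _ _ ≫ snd _ _ ≫ fst _ _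

/-- Weakening by one variable. -/
abbrev wk1 : A ⊗ Γ ⟶ Γ := snd _ _

/-- Weakening by two variables. -/
abbrev wk2 : A ⊗ (B ⊗ Γ) ⟶ Γ := snd _ _ ≫ snd _ _

end Variables

/-! ### Power objects, membership, comprehension -/

/-- The object of truth values. -/
abbrev Om (C : Type u) [Category.{v} C] [HasSubobjectClassifier C] : C :=
  HasSubobjectClassifier.Ω C

/-- The subobject classified by a morphism to the object of truth values. It is the formula given
by a term whose type is the object of truth values. -/
def ofTruth {Γ : C} (t : Γ ⟶ Om C) : Subobject Γ :=
  (Subobject.pullback t).obj (Subobject.mk (HasSubobjectClassifier.truth C))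

/-- The characteristic morphism of a subobject. -/
def chi {Γ : C} (φ : Subobject Γ) : Γ ⟶ Om C :=
  HasSubobjectClassifier.χ φ.arrow

/-- The power object `PX = Ω ^ X`. -/
abbrev P (X : C) : C := (ihom X).obj (Om C)

/-- The subobject `∈_X` of `X × PX`, whose characteristic morphism is the transpose of the
identity of `PX`. -/
def memSub (X : C) : Subobject (X ⊗ P X) := ofTruth (MonoidalClosed.uncurry (𝟙 (P X)))

/-- The formula `σ ∈_X τ`. -/
def mem {Γ X : C} (σ : Γ ⟶ X) (τ : Γ ⟶ P X) : Subobject Γ :=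
  (Subobject.pullback (lift σ τ)).obj (memSub X)

/-- The term `{x : X | φ}` of type `PX`, in the context `Γ`, for a formula `φ` in the context
`Γ, x : X`. -/
def compr {Γ X : C} (φ : Subobject (X ⊗ Γ)) : Γ ⟶ P X := MonoidalClosed.curry (chi φ)

/-! ### Formulas. The conjunction is the meet `⊓` of subobjects, truth is `⊤`. -/

/-- The formula `σ = τ`. -/
def eqF {Γ X : C} (σ τ : Γ ⟶ X) : Subobject Γ := equalizerSubobject σ τ

/-- The implication `φ ⇒ ψ` in the Heyting algebra of subobjects (see `le_impF_iff`): the equalizer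
of the characteristic morphisms of `φ ∧ ψ` and of `φ`. -/
def impF {Γ : C} (φ ψ : Subobject Γ) : Subobject Γ := eqF (chi (φ ⊓ ψ)) (chi φ)

/-- The formula `∀ x : X, φ`: the equalizer of `{x : X | φ}` and `{x : X | true}`. It is the value
at `φ` of the right adjoint of the pullback along the projection (see `le_allF_iff`). -/
def allF {Γ : C} (X : C) (φ : Subobject (X ⊗ Γ)) : Subobject Γ := eqF (compr φ) (compr ⊤)

section Semantics

set_option linter.unusedSectionVars false

variable {Γ Δ X Y : C}

theorem factors_pullback (f : Γ ⟶ Δ) (φ : Subobject Δ) (t : X ⟶ Γ) :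
    ((Subobject.pullback f).obj φ).Factors t ↔ φ.Factors (t ≫ f) := by
  have h := Subobject.isPullback f φ
  rw [← Subobject.mk_arrow ((Subobject.pullback f).obj φ)]
  conv_rhs => rw [← Subobject.mk_arrow φ]
  rw [Subobject.mk_factors_iff, Subobject.mk_factors_iff]
  constructor
  · rintro ⟨k, hk⟩
    refine ⟨k ≫ Subobject.pullbackπ f φ, ?_⟩
    rw [← hk]
    exact (Category.assoc _ _ _).trans
      ((congrArg (fun q => k ≫ q) h.w).trans (Category.assoc _ _ _).symm)
  · rintro ⟨k, hk⟩
    exact ⟨h.lift k t hk, h.lift_snd _ _ _⟩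

theorem le_iff_factors (φ ψ : Subobject Γ) :
    φ ≤ ψ ↔ ∀ (Z : C) (t : Z ⟶ Γ), φ.Factors t → ψ.Factors t := by
  constructor
  · intro h Z t ht
    exact Subobject.factors_of_le t h ht
  · intro h
    have := h _ φ.arrow (by
      rw [Subobject.factors_iff]; exact ⟨𝟙 _, by simp⟩)
    exact Subobject.le_of_comm (ψ.factorThru φ.arrow this) (by simp)

theorem factors_id_iff (φ : Subobject Γ) : φ.Factors (𝟙 Γ) ↔ φ = ⊤ := by
  constructor
  · intro h
    rw [eq_top_iff, le_iff_factors]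
    intro Z t _
    simpa using Subobject.factors_of_factors_right t h
  · rintro rfl
    exact Subobject.top_factors _

theorem ofTruth_chi (φ : Subobject Γ) : ofTruth (chi φ) = φ := by
  have := Subobject.Classifier.pullback_χ_obj_mk_truth
    (HasSubobjectClassifier.exists_classifier (C := C)).some φ.arrow
  rw [Subobject.mk_arrow] at this
  exact this

theorem chi_ofTruth (t : Γ ⟶ Om C) : chi (ofTruth t) = t :=
  Subobject.Classifier.χ_pullback_obj_mk_truth_arrow
    (HasSubobjectClassifier.exists_classifier (C := C)).some t

theorem comp_chi (t : Δ ⟶ Γ) (φ : Subobject Γ) :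
    t ≫ chi φ = chi ((Subobject.pullback t).obj φ) := by
  rw [← chi_ofTruth (t ≫ chi φ), ofTruth, Subobject.pullback_comp]
  exact congrArg (fun ψ => chi ((Subobject.pullback t).obj ψ)) (ofTruth_chi φ)

theorem chi_inj {φ ψ : Subobject Γ} : chi φ = chi ψ ↔ φ = ψ :=
  ⟨fun h => by rw [← ofTruth_chi φ, h, ofTruth_chi], fun h => by rw [h]⟩

theorem factors_eqF (σ τ : Γ ⟶ X) (t : Δ ⟶ Γ) :
    (eqF σ τ).Factors t ↔ t ≫ σ = t ≫ τ :=
  equalizerSubobject_factors_iff σ τ t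

theorem factors_impF (φ ψ : Subobject Γ) (t : Δ ⟶ Γ) :
    (impF φ ψ).Factors t ↔
      (Subobject.pullback t).obj φ ≤ (Subobject.pullback t).obj ψ := by
  rw [impF, factors_eqF, comp_chi, comp_chi, chi_inj, Subobject.inf_pullback, inf_eq_left]

theorem factors_allF (φ : Subobject (X ⊗ Γ)) (t : Δ ⟶ Γ) :
    (allF X φ).Factors t ↔ φ.Factors (X ◁ t) := by
  rw [allF, factors_eqF, compr, compr, ← MonoidalClosed.curry_natural_left,
    ← MonoidalClosed.curry_natural_left, (MonoidalClosed.curry_injective).eq_iff, comp_chi,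
    comp_chi, chi_inj, Subobject.pullback_top, ← factors_id_iff, factors_pullback,
    Category.id_comp]

/-- `impF` is the Heyting implication. -/
theorem le_impF_iff (χ φ ψ : Subobject Γ) : χ ≤ impF φ ψ ↔ χ ⊓ φ ≤ ψ := by
  simp only [le_iff_factors, factors_impF, factors_pullback, Subobject.inf_factors]
  constructor
  · rintro h Z t ⟨h1, h2⟩
    simpa using h Z t h1 Z (𝟙 Z) (by simpa using h2)
  · intro h Z t h1 W s h2
    exact h W _ ⟨Subobject.factors_of_factors_right s h1, h2⟩

/-- `allF X` is right adjoint to the pullback along the projection. -/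
theorem le_allF_iff (ψ : Subobject Γ) (φ : Subobject (X ⊗ Γ)) :
    ψ ≤ allF X φ ↔ (Subobject.pullback (snd X Γ)).obj ψ ≤ φ := by
  simp only [le_iff_factors, factors_allF, factors_pullback]
  constructor
  · intro h Z t ht
    have := Subobject.factors_of_factors_right (lift (t ≫ fst _ _) (𝟙 Z)) (h Z _ ht)
    have e : lift (t ≫ fst X Γ) (𝟙 Z) ≫ X ◁ (t ≫ snd X Γ) = t := by
      ext <;> simp
    rwa [e] at this
  · intro h Z t ht
    apply h
    rw [whiskerLeft_snd]
    exact Subobject.factors_of_factors_right _ ht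

/-- The smallest subobject through which `f` factors:
`{b | ∀ ω : Ω, (∀ a, f a = b ⇒ ω) ⇒ ω}`. Only used to show that images exist. -/
def imSub (f : X ⟶ Y) : Subobject Y :=
  allF (Om C) (impF (allF X (impF (eqF (v0 ≫ f) wk2) (ofTruth v1))) (ofTruth v0))

theorem imSub_factors (f : X ⟶ Y) : (imSub f).Factors f := by
  rw [imSub, factors_allF, factors_impF, le_iff_factors]
  intro Z h hh
  rw [factors_pullback, factors_allF, factors_impF, le_iff_factors] at hh
  have := hh Z (lift (h ≫ snd _ _) (𝟙 Z)) (by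
    rw [factors_pullback, factors_eqF]; simp)
  rw [factors_pullback, ofTruth, factors_pullback] at this
  rw [factors_pullback, ofTruth, factors_pullback]
  simpa using this

theorem imSub_le (f : X ⟶ Y) (S : Subobject Y) (hS : S.Factors f) : imSub f ≤ S := by
  rw [le_iff_factors]
  intro Z h hh
  rw [imSub, factors_allF] at hh
  have h2 := Subobject.factors_of_factors_right (lift (h ≫ chi S) (𝟙 Z)) hh
  rw [factors_impF, le_iff_factors] at h2
  have h3 := h2 Z (𝟙 Z) (by
    rw [factors_pullback, factors_allF, factors_impF, le_iff_factors]
    intro W k hk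
    rw [factors_pullback, factors_eqF] at hk
    rw [factors_pullback, ofTruth, factors_pullback]
    have hk' : k ≫ snd _ _ ≫ h = (k ≫ fst _ _) ≫ f := by simpa using hk.symm
    have : (ofTruth (chi S)).Factors (k ≫ snd _ _ ≫ h) := by
      rw [ofTruth_chi, hk']
      exact Subobject.factors_of_factors_right _ hS
    rw [ofTruth, factors_pullback] at this
    simpa using this)
  rw [factors_pullback, ofTruth, factors_pullback] at h3
  rw [← ofTruth_chi S, ofTruth, factors_pullback]
  simpa using h3

variable (C) in
/-- A topos has images. -/
theorem hasImages : HasImages C where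
  has_image f := HasImage.mk
    { F := { I := _
             m := (imSub f).arrow
             e := (imSub f).factorThru f (imSub_factors f) }
      isImage :=
        { lift := fun F' => Subobject.ofLE _ _ (imSub_le f (Subobject.mk F'.m)
            ((Subobject.mk_factors_iff _ _).2 ⟨F'.e, F'.fac⟩)) ≫ (Subobject.underlyingIso F'.m).hom
          lift_fac := fun F' => by simp } }

end Semantics

/-- The formula `∃ x : X, φ`: the image of the composite of the subobject `φ` of `X ⊗ Γ` with the
projection to `Γ`. -/
def exF {Γ : C} (X : C) (φ : Subobject (X ⊗ Γ)) : Subobject Γ :=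
  haveI := hasImages C
  imageSubobject (φ.arrow ≫ snd X Γ)

/-- The internal meet `∧ : PX × PX ⟶ PX`, `(Y, Z) ↦ {x : X | x ∈ Y ∧ x ∈ Z}`. -/
def meet (X : C) : P X ⊗ P X ⟶ P X :=
  compr (mem (fst X (P X ⊗ P X)) (snd _ _ ≫ fst _ _) ⊓
    mem (fst X (P X ⊗ P X)) (snd _ _ ≫ snd _ _))

/-- The term `σ ∧ τ` of type `PX`. -/
def inter {Γ X : C} (σ τ : Γ ⟶ P X) : Γ ⟶ P X := lift σ τ ≫ meet X

/-- The internal order `≼_X` of `PX`: the equalizer of `∧` and of the first projection. -/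
def leSub (X : C) : Subobject (P X ⊗ P X) := eqF (meet X) (fst _ _)

/-- The formula `σ ≼_X τ`. -/
def leF {Γ X : C} (σ τ : Γ ⟶ P X) : Subobject Γ := (Subobject.pullback (lift σ τ)).obj (leSub X)

/-- The object `X` as a term of type `PX`, that is `{x : X | true}`. -/
def univ {Γ : C} (X : C) : Γ ⟶ P X := compr ⊤

/-- Validity of a closed formula in the topos. -/
def Holds (φ : Subobject (𝟙_ C)) : Prop := φ = ⊤

infix:55 " ∈ᵢ " => mem
infix:55 " ≼ᵢ " => leF
infix:55 " =ᵢ " => eqF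
infixr:45 " ⇒ᵢ " => impF
infixl:60 " ∧ᵢ " => inter

/-! ### Filters and neighborhoods -/

section Filters

variable (X : C)

/-- In the context `F : PPX`: `∀ A, ∀ B, A ∈ F ∧ B ∈ F ⇒ A ∧ B ∈ F`. -/
def filterInter : Subobject (P (P X)) :=
  allF (P X) (allF (P X) ((v1 ∈ᵢ wk2) ⊓ (v0 ∈ᵢ wk2) ⇒ᵢ (v1 ∧ᵢ v0) ∈ᵢ wk2))

/-- In the context `F : PPX`: `∀ A, ∀ B, A ∈ F ∧ A ≼ B ⇒ B ∈ F`. -/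
def filterUpper : Subobject (P (P X)) :=
  allF (P X) (allF (P X) ((v1 ∈ᵢ wk2) ⊓ (v1 ≼ᵢ v0) ⇒ᵢ v0 ∈ᵢ wk2))

/-- In the context `F : PPX`: `X ∈ F`. -/
def filterNonempty : Subobject (P (P X)) := univ X ∈ᵢ 𝟙 (P (P X))

/-- In the context `F : PPX`: `∀ A, A ∈ F ⇒ ∃ x, x ∈ A`. -/
def filterStrict : Subobject (P (P X)) :=
  allF (P X) ((v0 ∈ᵢ wk1) ⇒ᵢ exF X (v0 ∈ᵢ v1))

/-- The morphism `PPX ⟶ Ω` which expresses that `F : PPX` is a filter. -/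
def filterMor : P (P X) ⟶ Om C :=
  chi (filterInter X ⊓ filterUpper X ⊓ filterNonempty X ⊓ filterStrict X)

end Filters

variable {X : C}

/-- Structuring neighborhoods. -/
structure IsStructuringNeighborhood (N : X ⟶ P (P X)) : Prop where
  /-- `∀ x, ℱ (N x)` -/
  filter : Holds (allF X (ofTruth ((v0 ≫ N) ≫ filterMor X)))
  /-- `∀ x, ∀ A, A ∈ N x ⇒ x ∈ A` -/
  self_mem : Holds (allF X (allF (P X) ((v0 ∈ᵢ v1 ≫ N) ⇒ᵢ v1 ∈ᵢ v0)))

/-- Topological neighborhoods. -/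
structure IsTopologicalNeighborhood (N : X ⟶ P (P X)) : Prop
    extends IsStructuringNeighborhood N where
  /-- `∀ x, ∀ A, A ∈ N x ⇒ ∃ B, B ∈ N x ∧ ∀ y, y ∈ B ⇒ A ∈ N y` -/
  open_mem : Holds (allF X (allF (P X) ((v0 ∈ᵢ v1 ≫ N) ⇒ᵢ
    exF (P X) ((v0 ∈ᵢ v2 ≫ N) ⊓ allF X ((v0 ∈ᵢ v1) ⇒ᵢ (v2 ∈ᵢ v0 ≫ N))))))

/-- The erosion `ε[N] : PX ⟶ PX`, `ε[N](Y) = {x : X | Y ∈ N x}`. -/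
def erosion (N : X ⟶ P (P X)) : P X ⟶ P X :=
  compr ((snd X (P X)) ∈ᵢ (fst X (P X) ≫ N))

/-- Internal interior operators on `PX`. -/
structure IsInteriorOperator (e : P X ⟶ P X) : Prop where
  /-- `∀ Y, e Y ≼ Y` -/
  anti_extensive : Holds (allF (P X) (v0 ≫ e ≼ᵢ v0))
  /-- `e X = X` -/
  map_univ : Holds (univ X ≫ e =ᵢ univ X)
  /-- `∀ Y, ∀ Z, e (Y ∧ Z) = e Y ∧ e Z` -/
  map_inter : Holds (allF (P X) (allF (P X) ((v1 ∧ᵢ v0) ≫ e =ᵢ (v1 ≫ e) ∧ᵢ (v0 ≫ e))))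
  /-- `∀ Y, e (e Y) = e Y` -/
  idempotent : Holds (allF (P X) ((v0 ≫ e) ≫ e =ᵢ v0 ≫ e))

end ToposLogic

end

/-! By Kripke–Joyal semantics the internal formulas become statements about generalized elements `x
: Γ ⟶ X` and `A : Γ ⟶ P X` at all stages `Γ`, and the set-theoretic proof then applies. Everything
rests on one equivalence, `isMem_comp_erosion`: `x` lies in the erosion of `A` iff `A` lies in `N
x`. Since `power_ext` and `inter_eq_left_iff` test equality and order on members, each interior
axiom turns into a property of `N x`. Deflation is axiom (b); preservation of `X` and of meets says
that `N x` contains `X`, is closed under meets and is upward closed; idempotence combines (b) with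
(c). The only existential to eliminate is in (c). No witness `B` need exist at the given stage: by
`exF_le_iff` it suffices to argue with a variable `B`, because the conclusion does not mention it.
-/

namespace ToposLogic

/-! ### Kripke–Joyal semantics of the formulas, in terms of generalized elements -/

section GeneralizedElements

variable {C : Type u} [Category.{v} C] [CartesianMonoidalCategory C] [HasFiniteLimits C]
  [MonoidalClosed C] [HasSubobjectClassifier C] {X Γ Δ : C}

/-- A generalized element `x` of `X` belongs to a generalized element `A` of `PX`. -/
def IsMem (x : Γ ⟶ X) (A : Γ ⟶ P X) : Prop := (memSub X).Factors (lift x A)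

theorem factors_mem (σ : Γ ⟶ X) (τ : Γ ⟶ P X) (t : Δ ⟶ Γ) :
    (mem σ τ).Factors t ↔ IsMem (t ≫ σ) (t ≫ τ) := by
  rw [mem, factors_pullback, comp_lift, IsMem]

theorem mem_eq_top_iff (σ : Γ ⟶ X) (τ : Γ ⟶ P X) : mem σ τ = ⊤ ↔ IsMem σ τ := by
  rw [← factors_id_iff, factors_mem, Category.id_comp, Category.id_comp]

theorem mem_eq_ofTruth (σ : Γ ⟶ X) (τ : Γ ⟶ P X) :
    mem σ τ = ofTruth (lift σ τ ≫ MonoidalClosed.uncurry (𝟙 (P X))) := by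
  rw [mem, memSub, ofTruth, ofTruth, Subobject.pullback_comp]

/-- The beta rule for comprehension: transposing `compr φ` back gives `chi φ`. -/
theorem isMem_compr (x : Δ ⟶ X) (A : Δ ⟶ Γ) (φ : Subobject (X ⊗ Γ)) :
    IsMem x (A ≫ compr φ) ↔ φ.Factors (lift x A) := by
  have e : lift x (A ≫ compr φ) ≫ MonoidalClosed.uncurry (𝟙 (P X)) = lift x A ≫ chi φ := by
    have h : X ◁ compr φ ≫ MonoidalClosed.uncurry (𝟙 (P X)) = chi φ := by
      rw [← MonoidalClosed.uncurry_natural_left, Category.comp_id, compr,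
        MonoidalClosed.uncurry_curry]
    rw [← h, ← Category.assoc, lift_whiskerLeft]
  rw [← mem_eq_top_iff, mem_eq_ofTruth, e, comp_chi, ofTruth_chi, ← factors_id_iff,
    factors_pullback, Category.id_comp]

theorem isMem_univ (x : Γ ⟶ X) : IsMem x (univ X) := by
  have h := (isMem_compr x (𝟙 Γ) ⊤).2 (Subobject.top_factors _)
  rwa [Category.id_comp] at h

theorem comp_univ (t : Δ ⟶ Γ) : t ≫ univ X = univ X := by
  rw [univ, univ, compr, compr, ← MonoidalClosed.curry_natural_left, comp_chi,
    Subobject.pullback_top]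

theorem comp_inter (t : Δ ⟶ Γ) (A B : Γ ⟶ P X) : t ≫ inter A B = inter (t ≫ A) (t ≫ B) := by
  rw [inter, inter, ← Category.assoc, comp_lift]

theorem isMem_inter (x : Γ ⟶ X) (A B : Γ ⟶ P X) :
    IsMem x (inter A B) ↔ IsMem x A ∧ IsMem x B := by
  rw [inter, meet, isMem_compr, Subobject.inf_factors, factors_mem, factors_mem]
  simp

/-- Extensionality of power objects. -/
theorem power_ext {A B : Γ ⟶ P X}
    (h : ∀ (Z : C) (t : Z ⟶ Γ) (x : Z ⟶ X), IsMem x (t ≫ A) ↔ IsMem x (t ≫ B)) : A = B := by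
  -- The eta rule: `D` is determined by its membership formula, so only these subobjects need
  -- comparing.
  have key (D : Γ ⟶ P X) : D = compr (mem (fst X Γ) (snd X Γ ≫ D)) := by
    rw [compr, mem_eq_ofTruth, chi_ofTruth, MonoidalClosed.eq_curry_iff,
      MonoidalClosed.uncurry_eq, MonoidalClosed.uncurry_eq]
    have e : lift (fst X Γ) (snd X Γ ≫ D) = X ◁ D := by ext <;> simp
    rw [e]
    simp
  rw [key A, key B]
  congr 1
  apply le_antisymm <;> rw [le_iff_factors] <;> intro Z t ht <;>
    rw [factors_mem, ← Category.assoc] at ht ⊢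
  · exact (h _ _ _).1 ht
  · exact (h _ _ _).2 ht

theorem inter_eq_left_iff (A B : Γ ⟶ P X) :
    inter A B = A ↔
      ∀ (Z : C) (t : Z ⟶ Γ) (x : Z ⟶ X), IsMem x (t ≫ A) → IsMem x (t ≫ B) := by
  constructor
  · intro h Z t x hx
    rw [← h, comp_inter, isMem_inter] at hx
    exact hx.2
  · intro h
    refine power_ext fun Z t x => ?_
    rw [comp_inter, isMem_inter]
    exact ⟨And.left, fun hx => ⟨hx, h Z t x hx⟩⟩

theorem factors_leF (σ τ : Γ ⟶ P X) (t : Δ ⟶ Γ) :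
    (leF σ τ).Factors t ↔ inter (t ≫ σ) (t ≫ τ) = t ≫ σ := by
  rw [leF, factors_pullback, leSub, factors_eqF, comp_lift, lift_fst, inter]

theorem leF_eq_top_iff (σ τ : Γ ⟶ P X) : leF σ τ = ⊤ ↔ inter σ τ = σ := by
  rw [← factors_id_iff, factors_leF, Category.id_comp, Category.id_comp]

theorem eqF_eq_top_iff (σ τ : Γ ⟶ X) : eqF σ τ = ⊤ ↔ σ = τ := by
  rw [← factors_id_iff, factors_eqF, Category.id_comp, Category.id_comp]

theorem factors_ofTruth_comp_chi (t : Δ ⟶ Γ) (σ : Γ ⟶ X) (φ : Subobject X) :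
    (ofTruth (σ ≫ chi φ)).Factors t ↔ φ.Factors (t ≫ σ) := by
  rw [comp_chi, ofTruth_chi, factors_pullback]

theorem allF_eq_top_iff (φ : Subobject (X ⊗ Γ)) : allF X φ = ⊤ ↔ φ = ⊤ := by
  rw [← top_le_iff, le_allF_iff, Subobject.pullback_top, top_le_iff]

theorem impF_eq_top_iff (φ ψ : Subobject Γ) : impF φ ψ = ⊤ ↔ φ ≤ ψ := by
  rw [← top_le_iff, le_impF_iff, top_inf_eq]

/-- Instantiation of a universal formula: restrict the generic instance along the section `lift x (𝟙
Δ)`. -/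
theorem factors_lift_of_allF {φ : Subobject (X ⊗ Γ)} {t : Δ ⟶ Γ} (h : (allF X φ).Factors t)
    (x : Δ ⟶ X) : φ.Factors (lift x t) := by
  rw [factors_allF] at h
  have := Subobject.factors_of_factors_right (lift x (𝟙 Δ)) h
  rwa [lift_whiskerLeft, Category.id_comp] at this

theorem factors_of_impF {φ ψ : Subobject Γ} {t : Δ ⟶ Γ} (h : (impF φ ψ).Factors t)
    (hφ : φ.Factors t) : ψ.Factors t := by
  rw [factors_impF, le_iff_factors] at h
  simpa [factors_pullback] using h Δ (𝟙 Δ) (by simpa [factors_pullback] using hφ)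

theorem le_exF (φ : Subobject (X ⊗ Γ)) : φ ≤ (Subobject.pullback (snd X Γ)).obj (exF X φ) := by
  have := hasImages C
  rw [le_iff_factors]
  intro Z t ht
  rw [factors_pullback, exF, ← Subobject.factorThru_arrow φ t ht, Category.assoc]
  apply Subobject.factors_of_factors_right
  exact (Subobject.factors_iff _ _).2 ⟨factorThruImageSubobject _, imageSubobject_arrow_comp _⟩

/-- `exF X` is left adjoint to the pullback along the projection. -/
theorem exF_le_iff (φ : Subobject (X ⊗ Γ)) (ψ : Subobject Γ) :
    exF X φ ≤ ψ ↔ φ ≤ (Subobject.pullback (snd X Γ)).obj ψ := by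
  have := hasImages C
  constructor
  · exact fun h => (le_exF φ).trans ((Subobject.pullback (snd X Γ)).monotone h)
  · intro h
    have hf : ψ.Factors (φ.arrow ≫ snd X Γ) := by
      rw [← factors_pullback]
      exact (le_iff_factors _ _).1 h _ _ ((Subobject.factors_iff _ _).2 ⟨𝟙 _, by simp⟩)
    exact imageSubobject_le _ (ψ.factorThru _ hf) (Subobject.factorThru_arrow _ _ hf)

theorem isMem_comp_erosion (N : X ⟶ P (P X)) (x : Γ ⟶ X) (A : Γ ⟶ P X) :
    IsMem x (A ≫ erosion N) ↔ IsMem A (x ≫ N) := by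
  rw [erosion, isMem_compr, factors_mem, lift_snd, lift_fst_assoc]

end GeneralizedElements

/-! ### The neighborhood axioms for generalized elements -/

section Neighborhoods

variable {C : Type u} [Category.{v} C] [CartesianMonoidalCategory C] [HasFiniteLimits C]
  [MonoidalClosed C] [HasSubobjectClassifier C] {X Γ : C} {N : X ⟶ P (P X)}

namespace IsStructuringNeighborhood

theorem isMem_of_isMem (hN : IsStructuringNeighborhood N) {x : Γ ⟶ X} {A : Γ ⟶ P X}
    (h : IsMem A (x ≫ N)) : IsMem x A := by
  have h1 := hN.self_mem
  rw [Holds, allF_eq_top_iff, allF_eq_top_iff, impF_eq_top_iff, le_iff_factors] at h1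
  have h2 := h1 Γ (lift A (lift x (toUnit Γ)))
  rw [factors_mem, factors_mem] at h2
  simpa using h2 (by simpa using h)

theorem factors_filter (hN : IsStructuringNeighborhood N) (x : Γ ⟶ X) :
    (filterInter X).Factors (x ≫ N) ∧ (filterUpper X).Factors (x ≫ N) ∧
      (filterNonempty X).Factors (x ≫ N) := by
  have h1 := hN.filter
  rw [Holds, allF_eq_top_iff, ← top_le_iff, le_iff_factors] at h1
  have h2 := h1 Γ (lift x (toUnit Γ)) (Subobject.top_factors _)
  rw [filterMor, factors_ofTruth_comp_chi, lift_fst_assoc, Subobject.inf_factors,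
    Subobject.inf_factors, Subobject.inf_factors] at h2
  exact ⟨h2.1.1.1, h2.1.1.2, h2.1.2⟩

theorem isMem_inter (hN : IsStructuringNeighborhood N) {x : Γ ⟶ X} {A B : Γ ⟶ P X}
    (hA : IsMem A (x ≫ N)) (hB : IsMem B (x ≫ N)) : IsMem (inter A B) (x ≫ N) := by
  have h := factors_of_impF
    (factors_lift_of_allF (factors_lift_of_allF (hN.factors_filter x).1 A) B)
    (by simpa [Subobject.inf_factors, factors_mem] using ⟨hA, hB⟩)
  simpa [factors_mem, comp_inter] using h

theorem isMem_of_inter_eq (hN : IsStructuringNeighborhood N) {x : Γ ⟶ X} {A B : Γ ⟶ P X}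
    (hA : IsMem A (x ≫ N)) (hAB : inter A B = A) : IsMem B (x ≫ N) := by
  have h := factors_of_impF
    (factors_lift_of_allF (factors_lift_of_allF (hN.factors_filter x).2.1 A) B)
    (by simpa [Subobject.inf_factors, factors_mem, factors_leF] using ⟨hA, hAB⟩)
  simpa [factors_mem] using h

theorem isMem_univ (hN : IsStructuringNeighborhood N) (x : Γ ⟶ X) :
    IsMem (univ X) (x ≫ N) := by
  have h := (hN.factors_filter x).2.2
  rwa [filterNonempty, factors_mem, comp_univ, Category.comp_id] at h

theorem isMem_inter_iff (hN : IsStructuringNeighborhood N) {x : Γ ⟶ X} {A B : Γ ⟶ P X} :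
    IsMem (inter A B) (x ≫ N) ↔ IsMem A (x ≫ N) ∧ IsMem B (x ≫ N) := by
  refine ⟨fun h => ⟨hN.isMem_of_inter_eq h ?_, hN.isMem_of_inter_eq h ?_⟩,
    fun h => hN.isMem_inter h.1 h.2⟩ <;>
  · rw [inter_eq_left_iff]
    intro Z t y hy
    rw [comp_inter, ToposLogic.isMem_inter] at hy
    simp only [hy]

end IsStructuringNeighborhood

/-- The set `B` given by (c) is contained in the erosion of `A`, so upward closure of `N x` applies.
-/
theorem IsTopologicalNeighborhood.isMem_comp_erosion (hN : IsTopologicalNeighborhood N)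
    {x : Γ ⟶ X} {A : Γ ⟶ P X} (h : IsMem A (x ≫ N)) : IsMem (A ≫ erosion N) (x ≫ N) := by
  have h1 := hN.open_mem
  rw [Holds, allF_eq_top_iff, allF_eq_top_iff, impF_eq_top_iff] at h1
  -- Proved in the generic context `x, A`, where the adjunction for `exF` makes `B` a new variable;
  -- specialized to the given `x` and `A` afterwards.
  have h2 := h1.trans
    (c := (v0 ≫ erosion N : P X ⊗ (X ⊗ 𝟙_ C) ⟶ P X) ∈ᵢ (v1 ≫ N)) <| by
    rw [exF_le_iff, le_iff_factors]
    intro Z t ht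
    rw [Subobject.inf_factors] at ht
    obtain ⟨hB, hall⟩ := ht
    rw [factors_mem] at hB
    rw [factors_pullback, factors_mem]
    have hB' : IsMem (t ≫ v0) ((t ≫ v2) ≫ N) := by simpa using hB
    have := hN.isMem_of_inter_eq hB' (B := (t ≫ v1) ≫ erosion N) <| by
      rw [inter_eq_left_iff]
      intro W s y hy
      have h3 := factors_of_impF
        (factors_lift_of_allF (Subobject.factors_of_factors_right s hall) y)
        (by simpa [factors_mem] using hy)
      rw [← Category.assoc, ToposLogic.isMem_comp_erosion]
      simpa [factors_mem] using h3
    simpa using this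
  have h4 := (le_iff_factors _ _).1 h2 Γ (lift A (lift x (toUnit Γ)))
    (by simpa [factors_mem] using h)
  simpa [factors_mem] using h4

end Neighborhoods

end ToposLogic

open ToposLogic in
theorem proposition8 {C : Type u} [Category.{v} C] [CartesianMonoidalCategory C]
    [HasFiniteLimits C] [MonoidalClosed C] [HasSubobjectClassifier C]
    {X : C} (N : X ⟶ ToposLogic.P (ToposLogic.P X))
    (hN : ToposLogic.IsTopologicalNeighborhood N) :
    ToposLogic.IsInteriorOperator (ToposLogic.erosion N) := by
  have hS := hN.toIsStructuringNeighborhood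
  constructor
  · rw [Holds, allF_eq_top_iff, leF_eq_top_iff, inter_eq_left_iff]
    intro Z t x hx
    rw [← Category.assoc, isMem_comp_erosion] at hx
    exact hS.isMem_of_isMem hx
  · rw [Holds, eqF_eq_top_iff]
    refine power_ext fun Z t x => ?_
    rw [← Category.assoc, comp_univ, isMem_comp_erosion]
    exact ⟨fun _ => isMem_univ x, fun _ => hS.isMem_univ x⟩
  · rw [Holds, allF_eq_top_iff, allF_eq_top_iff, eqF_eq_top_iff]
    refine power_ext fun Z t x => ?_
    rw [← Category.assoc, isMem_comp_erosion, comp_inter, comp_inter, isMem_inter,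
      hS.isMem_inter_iff, ← Category.assoc t _ (erosion N), ← Category.assoc t _ (erosion N),
      isMem_comp_erosion, isMem_comp_erosion]
  · rw [Holds, allF_eq_top_iff, eqF_eq_top_iff]
    refine power_ext fun Z t x => ?_
    rw [← Category.assoc, ← Category.assoc, isMem_comp_erosion, isMem_comp_erosion]
    -- Forward is (b) applied to the set `ε[N](Y)`; backward is (c).
    exact ⟨fun h => (isMem_comp_erosion N x _).1 (hS.isMem_of_isMem h), hN.isMem_comp_erosion⟩
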